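/- Let $d\ge 2$ and $L\ge 0$ be integers. Let $\mathbb S^d\subset\mathbb R^{d+1}$ be the unit sphere with (unnormalized) Lebesgue surface measure $\mu$ and geodesic distance $\mathrm{dist}(x,y)=\arccos(x\cdot y)$, let $B(\xi,r)=\{x\in\mathbb S^d:\mathrm{dist}(x,\xi)<r\}$, and let $\Pi_L$ be the space of all complex-valued spherical harmonics on $\mathbb S^d$ of degree at most $L$. For a basis $(Y_j)_{j\in J}$ of $\Pi_L$ and a finite set $\mathscr C\subset\mathbb S^d$ let $G_{\mathscr C}=\big(\sum_{\zeta\in\mathscr C}Y_j(\zeta)\overline{Y_k(\zeta)}\big)_{j,k\in J}$ be the corresponding Gram matrix, and let $\|\cdot\|_2$ denote the spectral norm of matrices. There are constants $c_0,r_0,C>0$ and $C'\in\mathbb R$ and an integer $\iota\ge L$, all depending only on $L$ and $d$, such that the following holds for every basis $(Y_j)$ of $\Pi_L$ that is orthonormal in $L^2(\mathbb S^d,\mu)$, every $\xi\in\mathbb S^d$ and every $0<r<r_0$. If $\mathscr C\subset B(\xi,r)$ is a finite set whose mesh norm satisfies $$\sup_{x\in B(\xi,r)}\ \min_{\zeta\in\mathscr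 C}\ \mathrm{dist}(x,\zeta)\le c_0 r ,$$ then $G_{\mathscr C}$ is invertible and $$\|G_{\mathscr C}^{-1}\|_2\le C\,r^{-2\iota}.$$ Moreover, if $L=1$ and $d=2$, one may take $\iota=2$, and then also $\|G_{\mathscr C}^{-1}\|_2\le 256\pi\, r^{-4}+C' r^{-2}$. (The empty set has mesh norm $\infty$.) -/

import Mathlib

open scoped BigOperators Matrix.Norms.L2Operator

noncomputable section

namespace SphereGram

/-- The unit sphere `𝕊^d` of `ℝ^{d+1}`. -/
abbrev Sph (d : ℕ) : Type := Metric.sphere (0 : EuclideanSpace ℝ (Fin (d + 1))) 1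

/-- Lebesgue (surface) measure `μ` on `𝕊^d`, without normalization (so `μ(𝕊²) = 4π`). -/
def surf (d : ℕ) : MeasureTheory.Measure (Sph d) :=
  (MeasureTheory.volume : MeasureTheory.Measure (EuclideanSpace ℝ (Fin (d + 1)))).toSphere

/-- Geodesic distance `arccos (x · y)` on the sphere. -/
def sdist {d : ℕ} (x y : Sph d) : ℝ :=
  Real.arccos (inner ℝ (x : EuclideanSpace ℝ (Fin (d + 1))) (y : EuclideanSpace ℝ (Fin (d + 1))))

/-- The spherical cap `B(ξ, r)`. -/
def cap {d : ℕ} (ξ : Sph d) (r : ℝ) : Set (Sph d) := {x | sdist x ξ < r}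

/-- The mesh norm `sup_{x ∈ S} min_{ζ ∈ Z} dist(x, ζ)` of `Z` in `S`. It takes values in `[0, ∞]`,
so that the mesh norm of the empty set in a nonempty `S` is `∞`. -/
def meshNorm {d : ℕ} (S : Set (Sph d)) (Z : Finset (Sph d)) : ENNReal :=
  ⨆ x ∈ S, ⨅ ζ ∈ Z, ENNReal.ofReal (sdist x ζ)

/-- The Laplacian `∑ ∂²/∂x_i²` on complex polynomials in `d + 1` variables. -/
def polyLaplacian (d : ℕ) :
    MvPolynomial (Fin (d + 1)) ℂ →ₗ[ℂ] MvPolynomial (Fin (d + 1)) ℂ :=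
  ∑ i, (MvPolynomial.pderiv i).toLinearMap ∘ₗ (MvPolynomial.pderiv i).toLinearMap

/-- Restriction of polynomials in `d + 1` variables to the sphere. -/
def restrictSph (d : ℕ) : MvPolynomial (Fin (d + 1)) ℂ →ₗ[ℂ] (Sph d → ℂ) :=
  LinearMap.pi fun x =>
    (MvPolynomial.aeval (R := ℂ)
      fun i => (((x : EuclideanSpace ℝ (Fin (d + 1))) i : ℝ) : ℂ)).toLinearMap

/-- Spherical harmonics of degree `l`: the restrictions to the sphere of the harmonic homogeneous
polynomials of degree `l`. -/
def sphHarm (d l : ℕ) : Submodule ℂ (Sph d → ℂ) :=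
  (MvPolynomial.homogeneousSubmodule (Fin (d + 1)) ℂ l ⊓ LinearMap.ker (polyLaplacian d)).map
    (restrictSph d)

/-- `Π_L`: the space of all spherical harmonics of degree at most `L` (the sum of the spaces of
spherical harmonics of degree `0, …, L`). -/
def PiSpace (d L : ℕ) : Submodule ℂ (Sph d → ℂ) := ⨆ l ∈ Finset.range (L + 1), sphHarm d l

/-- `Y` is a basis of `Π_L` that is orthonormal in `L²(𝕊^d, μ)`. -/
structure IsONBasis {d : ℕ} (L : ℕ) {J : Type} [DecidableEq J] (Y : J → Sph d → ℂ) : Prop where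
  orthonormal : ∀ j k, ∫ x, Y j x * (starRingEnd ℂ) (Y k x) ∂(surf d) = if j = k then 1 else 0
  span_eq : Submodule.span ℂ (Set.range Y) = PiSpace d L

/-- The Gram matrix `(⟨Y_j, Y_k⟩)_{j,k}` with respect to the inner product of `ℓ²(Z)`. -/
def gram {d : ℕ} {J : Type} (Y : J → Sph d → ℂ) (Z : Finset (Sph d)) : Matrix J J ℂ :=
  Matrix.of fun j k => ∑ ζ ∈ Z, Y j ζ * (starRingEnd ℂ) (Y k ζ)

end SphereGram

end

/-! Stereographic projection from `-ξ` carries small caps around `ξ` to small balls around `0`, and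
turns `f ∈ Π_L`, once multiplied by `(1 + |y|²)^L`, into a polynomial `∑ c_j φ_j(y)` of degree at
most `2L` (`stereoSpan_monoFun`). Fix finitely many nodes `p_i` in the open unit ball on which such
a polynomial vanishes only if it is zero. With `s = r/2`, a fine mesh supplies points `ζ_i` of `Z`
whose projections, divided by `s`, are as close to the `p_i` as desired.

Scaling by `s` multiplies a coefficient of degree `k ≤ 2L` by `s^k`, so at most a factor `s^(2L)` is
lost, and a compactness argument gives `M s^(4L) (∑ |c_j|)² ≤ ∑ |f(ζ_i)|²`
(`exists_scaled_lower_bound`). Since `|φ_j| ≤ (1 + |y|²)^L`, the sup norm of `f` is at most `∑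
|c_j|`; this yields `SamplingBound`.

Integrating the bound over the sphere, orthonormality bounds the quadratic form of the Gram matrix
below by `M (r/2)^(4L) / μ(𝕊^d)`, whence `ι = 2L`. For `L = 1`, `d = 2` an explicit five-point
configuration allows `M = 1/4`, and `μ(𝕊²) = 4π` then produces the constant `256π`. -/

open Filter Topology

open SphereGram

/-! ### Perturbation of positive homogeneous forms -/

/-- Positivity of a homogeneous function on `E ∖ {0}` is stable under perturbation of a
parameter. -/
theorem eventually_forall_pos_of_homogeneous {X E : Type*} [TopologicalSpace X]
    [NormedAddCommGroup E] [NormedSpace ℝ E] [FiniteDimensional ℝ E]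
    (F : X → E → ℝ) (hF : Continuous (Function.uncurry F))
    (hom : ∀ x (t : ℝ) c, F x (t • c) = t ^ 2 * F x c) (x₀ : X)
    (h0 : ∀ c, c ≠ 0 → 0 < F x₀ c) :
    ∀ᶠ x in 𝓝 x₀, ∀ c, 0 ≤ F x c := by
  have : ProperSpace E := FiniteDimensional.proper ℝ E
  -- Compactness of the unit sphere makes the neighbourhood uniform in `c`; homogeneity then reaches
  -- every `c`.
  have key : ∀ᶠ x in 𝓝 x₀, ∀ c ∈ Metric.sphere (0 : E) 1, 0 < F x c := by
    refine (isCompact_sphere (0 : E) 1).eventually_forall_of_forall_eventually fun c hc => ?_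
    have hc0 : c ≠ 0 := by
      rintro rfl
      simp at hc
    exact hF.continuousAt.eventually (lt_mem_nhds (h0 c hc0))
  filter_upwards [key] with x hx c
  by_cases hc : c = 0
  · have h := hom x 0 c
    rw [zero_smul] at h
    rw [hc, h]
    simp
  · have hn : ‖c‖ ≠ 0 := norm_ne_zero_iff.mpr hc
    have h1 : c = ‖c‖ • (‖c‖⁻¹ • c) := by
      rw [smul_smul, mul_inv_cancel₀ hn, one_smul]
    rw [h1, hom]
    refine mul_nonneg (sq_nonneg _) (hx _ ?_).le
    simp [norm_smul, hn]

/-- The perturbed parameter is the constant `m` itself: at `m = 0` the form is positive because the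
sampling map is injective. -/
theorem exists_pos_mul_sq_lt {n I : Type*} [Fintype n] [Fintype I]
    (a : I → n → ℝ) (w : n → ℝ)
    (h : ∀ c : n → ℂ, (∀ i, ∑ j, c j * (a i j : ℂ) = 0) → c = 0) :
    ∃ M : ℝ, 0 < M ∧ ∀ c : n → ℂ, c ≠ 0 →
      M * (∑ j, w j * ‖c j‖) ^ 2 < ∑ i, ‖∑ j, c j * (a i j : ℂ)‖ ^ 2 := by
  have hpos : ∀ c : n → ℂ, c ≠ 0 → 0 < ∑ i, ‖∑ j, c j * (a i j : ℂ)‖ ^ 2 := by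
    intro c hc
    refine lt_of_le_of_ne (Finset.sum_nonneg fun _ _ => sq_nonneg _) fun h0 => hc (h c fun i => ?_)
    have := (Finset.sum_eq_zero_iff_of_nonneg (fun _ _ => sq_nonneg _)).mp h0.symm i
      (Finset.mem_univ i)
    simpa using this
  have key := eventually_forall_pos_of_homogeneous (X := ℝ) (E := n → ℂ)
    (fun m c => ∑ i, ‖∑ j, c j * (a i j : ℂ)‖ ^ 2 - m * (∑ j, w j * ‖c j‖) ^ 2)
    (by unfold Function.uncurry; fun_prop)
    (by
      intro m t c
      simp only [Pi.smul_apply, norm_smul, smul_mul_assoc, ← Finset.smul_sum, mul_pow,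
        ← Finset.mul_sum, mul_left_comm (w _), Real.norm_eq_abs, sq_abs]
      ring) 0
    (fun c hc => by simpa using hpos c hc)
  obtain ⟨ε, hε, hball⟩ := Metric.eventually_nhds_iff.mp key
  -- The constant `ε / 2` gives a weak inequality; halving it again makes it strict, as the right
  -- side is positive.
  refine ⟨ε / 4, by positivity, fun c hc => ?_⟩
  have h1 := hball (y := ε / 2) (by simp [abs_of_pos hε, hε]) c
  have h2 := hpos c hc
  nlinarith

/-! ### Lower bounds at small scale -/

/-- The squared Euclidean length `∑ y_i²`. -/
def sqLen {d : ℕ} (y : Fin d → ℝ) : ℝ := ∑ i, y i ^ 2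

theorem sqLen_nonneg {d : ℕ} (y : Fin d → ℝ) : 0 ≤ sqLen y :=
  Finset.sum_nonneg fun _ _ => sq_nonneg _

theorem sqLen_smul {d : ℕ} (s : ℝ) (y : Fin d → ℝ) : sqLen (s • y) = s ^ 2 * sqLen y := by
  simp [sqLen, mul_pow, Finset.mul_sum]

theorem sq_le_sqLen {d : ℕ} (y : Fin d → ℝ) (i : Fin d) : y i ^ 2 ≤ sqLen y :=
  Finset.single_le_sum (f := fun i => y i ^ 2) (fun _ _ => sq_nonneg _) (Finset.mem_univ i)

@[fun_prop]
theorem continuous_sqLen {d : ℕ} : Continuous (sqLen (d := d)) := by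
  unfold sqLen
  fun_prop

/-- In the rescaled coefficients `s^(k_j) c_j` the left side has weights `s^(D - k_j)`, which extend
continuously to `s = 0`. There they become `0^(D - k_j)`, so only the coefficients of top degree `D`
matter in the hypothesis on `M`. Its strictness lets it survive small `s` and a small displacement
of the nodes. -/
theorem exists_scaled_lower_bound {d L D : ℕ} {n I : Type*} [Fintype n] [Fintype I]
    (φ : n → (Fin d → ℝ) → ℝ) (k : n → ℕ) (hφc : ∀ j, Continuous (φ j))
    (hk : ∀ j, k j ≤ D) (hφ : ∀ j (s : ℝ) y, φ j (s • y) = s ^ k j * φ j y)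
    (p : I → Fin d → ℝ) (hp : Function.Injective p) (M : ℝ)
    (hM : ∀ c : n → ℂ, c ≠ 0 →
      M * (∑ j, (0 : ℝ) ^ (D - k j) * ‖c j‖) ^ 2 < ∑ i, ‖∑ j, c j * (φ j (p i) : ℂ)‖ ^ 2) :
    ∃ δ : ℝ, 0 < δ ∧ ∀ s : ℝ, 0 < s → s < δ → ∀ z : I → Fin d → ℝ,
      (∀ i, dist (z i) (p i) < δ) → Function.Injective z ∧
      ∀ c : n → ℂ, M * s ^ (2 * D) * (∑ j, ‖c j‖) ^ 2 ≤
        ∑ i, ‖(((1 + sqLen (s • z i)) ^ L)⁻¹ : ℝ) • ∑ j, c j * (φ j (s • z i) : ℂ)‖ ^ 2 := by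
  have hpos : ∀ (s : ℝ) (y : Fin d → ℝ), 1 + sqLen (s • y) ≠ 0 := fun s y =>
    (add_pos_of_pos_of_nonneg one_pos (sqLen_nonneg _)).ne'
  have key := eventually_forall_pos_of_homogeneous (X := ℝ × (I → Fin d → ℝ)) (E := n → ℂ)
    (fun x c => ∑ i, ‖(((1 + sqLen (x.1 • x.2 i)) ^ L)⁻¹ : ℝ) •
        ∑ j, c j * (φ j (x.2 i) : ℂ)‖ ^ 2 - M * (∑ j, x.1 ^ (D - k j) * ‖c j‖) ^ 2)
    (by
      unfold Function.uncurry
      have : ∀ j, Continuous (φ j) := hφc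
      have h2 : ∀ i, Continuous fun x : (ℝ × (I → Fin d → ℝ)) × (n → ℂ) =>
          ((1 + sqLen (x.1.1 • x.1.2 i)) ^ L)⁻¹ := fun i =>
        Continuous.inv₀ (by fun_prop) fun x => pow_ne_zero _ (hpos _ _)
      have h3 : ∀ i j, Continuous fun x : (ℝ × (I → Fin d → ℝ)) × (n → ℂ) =>
          (φ j (x.1.2 i) : ℂ) := fun i j =>
        Complex.continuous_ofReal.comp ((hφc j).comp (by fun_prop))
      refine Continuous.sub (continuous_finsetSum _ fun i _ => ?_) (by fun_prop)
      exact (((h2 i).smul (continuous_finsetSum _ fun j _ =>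
        Continuous.mul (by fun_prop) (h3 i j))).norm).pow 2)
    (by
      intro x t c
      simp only [Pi.smul_apply, norm_smul, smul_mul_assoc, ← Finset.smul_sum, mul_pow,
        ← Finset.mul_sum, mul_left_comm (x.1 ^ _), Real.norm_eq_abs, sq_abs]
      rw [mul_sub, Finset.mul_sum]
      congr 1
      · exact Finset.sum_congr rfl fun i _ => by ring
      · ring) (0, p)
    (by
      intro c hc
      have := hM c hc
      simp only [zero_smul, sqLen, Pi.zero_apply]
      simpa using this)
  have hinj : ∀ᶠ x : ℝ × (I → Fin d → ℝ) in 𝓝 (0, p), Function.Injective x.2 := by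
    have : ∀ᶠ x : ℝ × (I → Fin d → ℝ) in 𝓝 (0, p), ∀ i j, i ≠ j → x.2 i ≠ x.2 j := by
      refine eventually_all.mpr fun i => eventually_all.mpr fun j => ?_
      by_cases hij : i = j
      · simp [hij]
      · have h1 : IsOpen {x : ℝ × (I → Fin d → ℝ) | x.2 i ≠ x.2 j} :=
          isOpen_ne_fun (by fun_prop) (by fun_prop)
        filter_upwards [h1.mem_nhds (show ((0 : ℝ), p) ∈ _ from hp.ne hij)] with x hx _
        exact hx
    filter_upwards [this] with x hx i j hij
    by_contra h
    exact hx i j h hij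
  obtain ⟨ε, hε, hball⟩ := Metric.eventually_nhds_iff.mp (key.and hinj)
  refine ⟨ε, hε, fun s hs hsε z hz => ?_⟩
  have hd : dist (s, z) ((0 : ℝ), p) < ε := by
    rw [Prod.dist_eq, max_lt_iff]
    exact ⟨by simpa [abs_of_pos hs] using hsε, (dist_pi_lt_iff hε).mpr hz⟩
  refine ⟨(hball hd).2, fun c => ?_⟩
  -- These coefficients absorb the homogeneity: `φ_j(s z) = s^(k_j) φ_j(z)`.
  have h := (hball hd).1 fun j => (s : ℂ) ^ k j * c j
  simp only [sub_nonneg] at h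
  refine le_of_eq_of_le ?_ (h.trans_eq ?_)
  · rw [pow_mul', mul_assoc, ← mul_pow, Finset.mul_sum]
    congr 3
    funext j
    rw [norm_mul, norm_pow, Complex.norm_real, Real.norm_of_nonneg hs.le, ← mul_assoc, ← pow_add,
      Nat.sub_add_cancel (hk j)]
  · refine Finset.sum_congr rfl fun i _ => ?_
    congr 4
    funext j
    rw [hφ]
    push_cast
    ring

/-! ### Stereographic projection -/

/-- The coordinates of `(1 + |y|²)` times the inverse stereographic projection of `y`. -/
def stereoNum {d : ℕ} (y : Fin d → ℝ) : Fin (d + 1) → ℝ :=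
  Fin.cons (1 - sqLen y) fun i => 2 * y i

theorem sum_stereoNum_sq {d : ℕ} (y : Fin d → ℝ) :
    ∑ j, stereoNum y j ^ 2 = (1 + sqLen y) ^ 2 := by
  rw [Fin.sum_univ_succ]
  simp only [stereoNum, Fin.cons_zero, Fin.cons_succ, mul_pow, ← Finset.mul_sum]
  change _ + 2 ^ 2 * sqLen y = _
  ring

theorem one_add_sqLen_pos {d : ℕ} (y : Fin d → ℝ) : 0 < 1 + sqLen y :=
  add_pos_of_pos_of_nonneg one_pos (sqLen_nonneg y)

theorem norm_stereoVec {d : ℕ}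
    (b : OrthonormalBasis (Fin (d + 1)) ℝ (EuclideanSpace ℝ (Fin (d + 1)))) (y : Fin d → ℝ) :
    ‖b.repr.symm (WithLp.toLp 2 ((1 + sqLen y)⁻¹ • stereoNum y))‖ = 1 := by
  rw [LinearIsometryEquiv.norm_map, EuclideanSpace.norm_eq, Real.sqrt_eq_one]
  simp only [Pi.smul_apply, smul_eq_mul, Real.norm_eq_abs, sq_abs, mul_pow, ← Finset.mul_sum]
  rw [sum_stereoNum_sq, ← mul_pow, inv_mul_cancel₀ (one_add_sqLen_pos y).ne', one_pow]

/-- Inverse stereographic projection, in the coordinates of an orthonormal basis `b`; it sends `0`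
to `b 0`. -/
noncomputable def stereo {d : ℕ} (b : OrthonormalBasis (Fin (d + 1)) ℝ (EuclideanSpace ℝ (Fin (d + 1))))
    (y : Fin d → ℝ) : Sph d :=
  ⟨b.repr.symm (WithLp.toLp 2 ((1 + sqLen y)⁻¹ • stereoNum y)), by
    rw [mem_sphere_zero_iff_norm]
    exact norm_stereoVec b y⟩

theorem inner_stereo {d : ℕ}
    (b : OrthonormalBasis (Fin (d + 1)) ℝ (EuclideanSpace ℝ (Fin (d + 1)))) (y : Fin d → ℝ)
    (j : Fin (d + 1)) :
    inner ℝ (b j) (stereo b y : EuclideanSpace ℝ (Fin (d + 1))) =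
      (1 + sqLen y)⁻¹ * stereoNum y j := by
  rw [← b.repr_apply_apply]
  simp [stereo]

theorem stereo_apply {d : ℕ}
    (b : OrthonormalBasis (Fin (d + 1)) ℝ (EuclideanSpace ℝ (Fin (d + 1)))) (y : Fin d → ℝ)
    (i : Fin (d + 1)) :
    (stereo b y : EuclideanSpace ℝ (Fin (d + 1))) i =
      (1 + sqLen y)⁻¹ * ∑ j, stereoNum y j * (b j) i := by
  have h := b.sum_repr' (stereo b y : EuclideanSpace ℝ (Fin (d + 1)))
  conv_lhs => rw [← h]
  simp [inner_stereo, Finset.mul_sum, mul_assoc]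

/-- Stereographic projection in the coordinates of an orthonormal basis. -/
noncomputable def stereoInv {d : ℕ} (b : OrthonormalBasis (Fin (d + 1)) ℝ (EuclideanSpace ℝ (Fin (d + 1))))
    (x : Sph d) : Fin d → ℝ := fun i =>
  inner ℝ (b i.succ) (x : EuclideanSpace ℝ (Fin (d + 1))) /
    (1 + inner ℝ (b 0) (x : EuclideanSpace ℝ (Fin (d + 1))))

theorem sum_inner_sq_eq_one {d : ℕ}
    (b : OrthonormalBasis (Fin (d + 1)) ℝ (EuclideanSpace ℝ (Fin (d + 1)))) (x : Sph d) :
    inner ℝ (b 0) (x : EuclideanSpace ℝ (Fin (d + 1))) ^ 2 +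
      ∑ i : Fin d, inner ℝ (b i.succ) (x : EuclideanSpace ℝ (Fin (d + 1))) ^ 2 = 1 := by
  have h := b.sum_sq_norm_inner_right (x : EuclideanSpace ℝ (Fin (d + 1)))
  rw [Fin.sum_univ_succ] at h
  simpa using h

theorem stereo_stereoInv {d : ℕ}
    (b : OrthonormalBasis (Fin (d + 1)) ℝ (EuclideanSpace ℝ (Fin (d + 1)))) (x : Sph d)
    (hx : 1 + inner ℝ (b 0) (x : EuclideanSpace ℝ (Fin (d + 1))) ≠ 0) :
    stereo b (stereoInv b x) = x := by
  set t := inner ℝ (b 0) (x : EuclideanSpace ℝ (Fin (d + 1))) with ht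
  have h1 : sqLen (stereoInv b x) = (1 - t) / (1 + t) := by
    have h := sum_inner_sq_eq_one b x
    rw [← ht] at h
    simp only [sqLen, stereoInv, div_pow, ← Finset.sum_div, ← ht]
    rw [div_eq_div_iff (pow_ne_zero _ hx) hx]
    linear_combination (1 + t) * h
  have h2 : (1 + sqLen (stereoInv b x))⁻¹ = (1 + t) / 2 := by
    rw [h1]
    field_simp
    ring
  apply Subtype.ext
  apply b.repr.injective
  ext j
  rw [b.repr_apply_apply, b.repr_apply_apply, inner_stereo, h2]
  refine Fin.cases ?_ (fun i => ?_) j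
  · simp only [stereoNum, Fin.cons_zero, h1, ← ht]
    field_simp
    ring
  · simp only [stereoNum, Fin.cons_succ, stereoInv, ← ht]
    field_simp

/-- The geodesic distance from `stereo b y` to `b 0` is `2 arctan |y|`, which is at most `2 |y|`. -/
theorem stereo_mem_cap {d : ℕ}
    (b : OrthonormalBasis (Fin (d + 1)) ℝ (EuclideanSpace ℝ (Fin (d + 1)))) {ξ : Sph d}
    (hb : b 0 = ξ) {r : ℝ} (hr : 0 < r) (y : Fin d → ℝ) (hy : sqLen y < (r / 2) ^ 2) :
    stereo b y ∈ cap ξ r := by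
  have ha : Real.arctan (√(sqLen y)) ≤ √(sqLen y) := by
    by_contra! h
    have h1 := Real.lt_tan (lt_of_le_of_lt (Real.sqrt_nonneg _) h) (Real.arctan_lt_pi_div_two _)
    rw [Real.tan_arctan] at h1
    exact absurd h (not_lt.mpr h1.le)
  have h0 : 0 ≤ Real.arctan (√(sqLen y)) := Real.arctan_nonneg.mpr (Real.sqrt_nonneg _)
  have hs : √(sqLen y) < r / 2 := by
    rw [Real.sqrt_lt' (by positivity)]
    exact hy
  have hc : inner ℝ (stereo b y : EuclideanSpace ℝ (Fin (d + 1))) (ξ : EuclideanSpace ℝ _) =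
      Real.cos (2 * Real.arctan (√(sqLen y))) := by
    have h := one_add_sqLen_pos y
    rw [real_inner_comm, ← hb, inner_stereo, Real.cos_two_mul, Real.cos_sq_arctan,
      Real.sq_sqrt (sqLen_nonneg y)]
    simp only [stereoNum, Fin.cons_zero]
    field_simp
    ring
  change Real.arccos _ < r
  rw [hc, Real.arccos_cos (by positivity) (by linarith [Real.arctan_lt_pi_div_two (√(sqLen y))])]
  linarith

theorem norm_sub_le_sdist {d : ℕ} (x y : Sph d) :
    ‖(x : EuclideanSpace ℝ (Fin (d + 1))) - y‖ ≤ sdist x y := by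
  have hx : ‖(x : EuclideanSpace ℝ (Fin (d + 1)))‖ = 1 := mem_sphere_zero_iff_norm.mp x.2
  have hy : ‖(y : EuclideanSpace ℝ (Fin (d + 1)))‖ = 1 := mem_sphere_zero_iff_norm.mp y.2
  have hle : |inner ℝ (x : EuclideanSpace ℝ (Fin (d + 1))) y| ≤ 1 := by
    simpa [hx, hy] using abs_real_inner_le_norm (x : EuclideanSpace ℝ (Fin (d + 1))) y
  refine abs_le_of_sq_le_sq' ?_ (Real.arccos_nonneg _) |>.2
  rw [norm_sub_sq_real, hx, hy]
  -- The squared chord is `2 - 2 cos θ`, hence at most `θ²`.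
  have h := Real.one_sub_sq_div_two_le_cos (x := sdist x y)
  rw [sdist, Real.cos_arccos (abs_le.mp hle).1 (abs_le.mp hle).2] at h
  linarith

theorem abs_stereoInv_sub_le {d : ℕ}
    (b : OrthonormalBasis (Fin (d + 1)) ℝ (EuclideanSpace ℝ (Fin (d + 1)))) (y : Fin d → ℝ)
    (hy : sqLen y ≤ 1) (x : Sph d)
    (hx : 0 ≤ inner ℝ (b 0) (x : EuclideanSpace ℝ (Fin (d + 1)))) (i : Fin d) :
    |stereoInv b x i - y i| ≤ 2 * sdist (stereo b y) x := by
  set t := inner ℝ (b 0) (x : EuclideanSpace ℝ (Fin (d + 1))) with ht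
  set x₀ := stereo b y
  have hd : ∀ j, |inner ℝ (b j) (x : EuclideanSpace ℝ (Fin (d + 1))) -
      inner ℝ (b j) (x₀ : EuclideanSpace ℝ (Fin (d + 1)))| ≤ sdist x₀ x := by
    intro j
    rw [← inner_sub_right]
    refine (abs_real_inner_le_norm _ _).trans ?_
    rw [b.orthonormal.1 j, one_mul, norm_sub_rev]
    exact norm_sub_le_sdist _ _
  have hyi : |y i| ≤ 1 := by
    have := (sq_le_sqLen y i).trans hy
    rwa [sq_le_one_iff_abs_le_one] at this
  have hpos := one_add_sqLen_pos y
  have h0 := hd 0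
  have h1 := hd i.succ
  rw [inner_stereo] at h0 h1
  simp only [stereoNum, Fin.cons_zero, Fin.cons_succ] at h0 h1
  rw [← ht] at h0
  -- Writing `x_0`, `x_i` for coordinates of `x` and `x'_0`, `x'_i` for those of `stereo b y`, the
  -- identity `x'_i = y_i (1 + x'_0)` leaves only differences of coordinates in the numerator; the
  -- denominator is at least `1`.
  have key : stereoInv b x i - y i =
      ((inner ℝ (b i.succ) (x : EuclideanSpace ℝ (Fin (d + 1))) - (1 + sqLen y)⁻¹ * (2 * y i)) -
        y i * (t - (1 + sqLen y)⁻¹ * (1 - sqLen y))) / (1 + t) := by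
    simp only [stereoInv, ← ht]
    field_simp
    ring
  rw [key, abs_div, abs_of_pos (by positivity : 0 < 1 + t), div_le_iff₀ (by positivity)]
  refine (abs_sub _ _).trans ?_
  rw [abs_mul]
  have h2 : |y i| * |t - (1 + sqLen y)⁻¹ * (1 - sqLen y)| ≤ 1 * sdist x₀ x :=
    mul_le_mul hyi h0 (abs_nonneg _) zero_le_one
  have h3 : 0 ≤ sdist x₀ x := Real.arccos_nonneg _
  nlinarith

/-! ### Caps, mesh norm and density of the chart -/

theorem exists_orthonormalBasis_zero_eq {d : ℕ} (ξ : Sph d) :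
    ∃ b : OrthonormalBasis (Fin (d + 1)) ℝ (EuclideanSpace ℝ (Fin (d + 1))), b 0 = ξ := by
  have hξ : ‖(ξ : EuclideanSpace ℝ (Fin (d + 1)))‖ = 1 := mem_sphere_zero_iff_norm.mp ξ.2
  obtain ⟨b, hb⟩ := Orthonormal.exists_orthonormalBasis_extension_of_card_eq (𝕜 := ℝ)
    (E := EuclideanSpace ℝ (Fin (d + 1))) (ι := Fin (d + 1)) (by simp)
    (v := fun _ => (ξ : EuclideanSpace ℝ (Fin (d + 1)))) (s := {0})
    ⟨fun _ => hξ, fun i j hij => absurd (Subsingleton.elim i j) hij⟩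
  exact ⟨b, hb 0 rfl⟩

theorem exists_sdist_lt_of_meshNorm_le {d : ℕ} {S : Set (Sph d)} {Z : Finset (Sph d)} {a a' : ℝ}
    (h : meshNorm S Z ≤ ENNReal.ofReal a) (ha : 0 ≤ a) (haa : a < a') {x : Sph d} (hx : x ∈ S) :
    ∃ ζ ∈ Z, sdist x ζ < a' := by
  have h1 : ⨅ ζ ∈ Z, ENNReal.ofReal (sdist x ζ) ≤ ENNReal.ofReal a :=
    (le_iSup₂ (f := fun x (_ : x ∈ S) => ⨅ ζ ∈ Z, ENNReal.ofReal (sdist x ζ)) x hx).trans h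
  have h2 : ⨅ ζ ∈ Z, ENNReal.ofReal (sdist x ζ) < ENNReal.ofReal a' :=
    h1.trans_lt ((ENNReal.ofReal_lt_ofReal_iff (ha.trans_lt haa)).mpr haa)
  simp only [iInf_lt_iff] at h2
  obtain ⟨ζ, hζ, hlt⟩ := h2
  exact ⟨ζ, hζ, (ENNReal.ofReal_lt_ofReal_iff (ha.trans_lt haa)).mp hlt⟩

theorem inner_nonneg_of_mem_cap {d : ℕ} {ξ x : Sph d} {r : ℝ} (hr : r ≤ 1) (hx : x ∈ cap ξ r) :
    0 ≤ inner ℝ (ξ : EuclideanSpace ℝ (Fin (d + 1))) (x : EuclideanSpace ℝ (Fin (d + 1))) := by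
  rw [real_inner_comm, ← Real.arccos_le_pi_div_two]
  change Real.arccos _ < r at hx
  linarith [Real.pi_gt_three]

theorem forall_norm_le_of_stereo {d : ℕ} (hd : 1 ≤ d)
    (b : OrthonormalBasis (Fin (d + 1)) ℝ (EuclideanSpace ℝ (Fin (d + 1)))) {f : Sph d → ℂ}
    (hf : Continuous f) {K : ℝ} (h : ∀ y, ‖f (stereo b y)‖ ≤ K) (x : Sph d) : ‖f x‖ ≤ K := by
  have hrank : 1 < Module.rank ℝ (EuclideanSpace ℝ (Fin (d + 1))) := by
    rw [← Module.finrank_eq_rank, finrank_euclideanSpace_fin]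
    exact_mod_cast Nat.lt_succ_of_le hd
  have hconn : ConnectedSpace (Sph d) :=
    isConnected_iff_connectedSpace.mp (isConnected_sphere hrank 0 zero_le_one)
  have hb0 : ‖b 0‖ = 1 := b.orthonormal.1 0
  let s₀ : Sph d := ⟨-b 0, by simp [hb0]⟩
  let n₀ : Sph d := ⟨b 0, by simp [hb0]⟩
  have hne : n₀ ≠ s₀ := by
    intro he
    have h1 : b 0 = -b 0 := congrArg Subtype.val he
    have h2 : (2 : ℝ) • b 0 = 0 := by
      rw [two_smul]
      nth_rewrite 1 [h1]
      exact neg_add_cancel _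
    have h3 := congrArg norm h2
    rw [norm_smul, hb0] at h3
    norm_num at h3
  have : Nontrivial (Sph d) := ⟨⟨n₀, s₀, hne⟩⟩
  -- A connected sphere with two points has no isolated point, so the chart, which omits only `s₀`,
  -- is dense.
  have := ConnectedSpace.neBot_nhdsWithin_compl_of_nontrivial_of_t1space s₀
  have hdense : Dense ({s₀}ᶜ : Set (Sph d)) := dense_compl_singleton s₀
  have hcl : IsClosed {x | ‖f x‖ ≤ K} := isClosed_le (by fun_prop) continuous_const
  refine hcl.closure_subset_iff.mpr (fun x hx => ?_) (hdense x)
  have hxn : ‖(x : EuclideanSpace ℝ (Fin (d + 1)))‖ = 1 := mem_sphere_zero_iff_norm.mp x.2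
  rw [Set.mem_ofPred_eq, ← stereo_stereoInv b x]
  · exact h _
  · intro h0
    refine hx (Subtype.ext ?_)
    change (x : EuclideanSpace ℝ (Fin (d + 1))) = -b 0
    rw [eq_neg_iff_add_eq_zero, ← norm_eq_zero, ← sq_eq_zero_iff, norm_add_sq_real, hxn, hb0,
      real_inner_comm]
    linarith

/-! ### Spherical harmonics as polynomials in the chart -/

theorem exists_mvPolynomial_of_mem_PiSpace {d L : ℕ} {f : Sph d → ℂ} (hf : f ∈ PiSpace d L) :
    ∃ p : MvPolynomial (Fin (d + 1)) ℂ, p.totalDegree ≤ L ∧ restrictSph d p = f := by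
  have h : PiSpace d L ≤ (MvPolynomial.restrictTotalDegree (Fin (d + 1)) ℂ L).map
      (restrictSph d) := by
    refine iSup₂_le fun l hl => Submodule.map_mono fun p hp => ?_
    rw [MvPolynomial.mem_restrictTotalDegree]
    exact (MvPolynomial.IsHomogeneous.totalDegree_le
      ((MvPolynomial.mem_homogeneousSubmodule _ _).mp hp.1)).trans
      (Nat.lt_succ_iff.mp (Finset.mem_range.mp hl))
  obtain ⟨p, hp, rfl⟩ := h hf
  exact ⟨p, (MvPolynomial.mem_restrictTotalDegree _ _ _).mp hp, rfl⟩

theorem restrictSph_apply {d : ℕ} (p : MvPolynomial (Fin (d + 1)) ℂ) (x : Sph d) :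
    restrictSph d p x = ∑ m ∈ p.support, p.coeff m *
      ∏ i, (((x : EuclideanSpace ℝ (Fin (d + 1))) i : ℝ) : ℂ) ^ m i :=
  MvPolynomial.eval₂_eq' _ _ _

theorem continuous_of_mem_PiSpace {d L : ℕ} {f : Sph d → ℂ} (hf : f ∈ PiSpace d L) :
    Continuous f := by
  obtain ⟨p, -, rfl⟩ := exists_mvPolynomial_of_mem_PiSpace hf
  have : restrictSph d p = fun x => _ := funext (restrictSph_apply p)
  rw [this]
  have h : ∀ i, Continuous fun x : Sph d =>
      (((x : EuclideanSpace ℝ (Fin (d + 1))) i : ℝ) : ℂ) := fun i =>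
    Complex.continuous_ofReal.comp (by fun_prop)
  fun_prop

/-- The `k`-th ambient coordinate of `(1 + |y|²)` times the inverse stereographic projection
of `y`. -/
noncomputable def stereoCoord {d : ℕ}
    (b : OrthonormalBasis (Fin (d + 1)) ℝ (EuclideanSpace ℝ (Fin (d + 1))))
    (k : Fin (d + 1)) (y : Fin d → ℝ) : ℝ :=
  ∑ j, stereoNum y j * (b j) k

theorem restrictSph_stereo {d L : ℕ}
    (b : OrthonormalBasis (Fin (d + 1)) ℝ (EuclideanSpace ℝ (Fin (d + 1))))
    {p : MvPolynomial (Fin (d + 1)) ℂ} (hp : p.totalDegree ≤ L) (y : Fin d → ℝ) :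
    (((1 + sqLen y) ^ L : ℝ) : ℂ) * restrictSph d p (stereo b y) =
      ∑ m ∈ p.support, p.coeff m * (((1 + sqLen y) ^ (L - m.degree) : ℝ) *
        ∏ k, (stereoCoord b k y : ℂ) ^ m k) := by
  rw [restrictSph_apply, Finset.mul_sum]
  refine Finset.sum_congr rfl fun m hm => ?_
  have hdeg : m.degree ≤ L := (MvPolynomial.le_totalDegree hm).trans hp
  have hs : ((1 + sqLen y : ℝ) : ℂ) ≠ 0 := by exact_mod_cast (one_add_sqLen_pos y).ne'
  have h1 : ∀ k, (((stereo b y : EuclideanSpace ℝ (Fin (d + 1))) k : ℝ) : ℂ) =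
      ((1 + sqLen y : ℝ) : ℂ)⁻¹ * (stereoCoord b k y : ℂ) := by
    intro k
    rw [stereo_apply, stereoCoord]
    push_cast
    rfl
  simp only [h1, mul_pow, Finset.prod_mul_distrib, Finset.prod_pow_eq_pow_sum]
  rw [← Finsupp.degree_eq_sum]
  nth_rewrite 1 [← Nat.sub_add_cancel hdeg]
  push_cast at hs ⊢
  rw [pow_add, inv_pow]
  field_simp

/-- The rescaled pullbacks of functions of `Π_L` under stereographic projection lie in the span of
the functions `φ_j`. -/
def StereoSpan (d L : ℕ) {n : Type*} (φ : n → (Fin d → ℝ) → ℝ) : Prop :=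
  ∀ (b : OrthonormalBasis (Fin (d + 1)) ℝ (EuclideanSpace ℝ (Fin (d + 1)))),
    ∀ f ∈ PiSpace d L, (fun y => (((1 + sqLen y) ^ L : ℝ) : ℂ) * f (stereo b y)) ∈
      Submodule.span ℂ (Set.range fun j y => (φ j y : ℂ))

/-- The exponents of the monomials of degree at most `D` in `d` variables. -/
abbrev Expo (d D : ℕ) : Type := {m : Fin d →₀ ℕ // m.degree ≤ D}

noncomputable instance fintypeExpo (d D : ℕ) : Fintype (Expo d D) :=
  (Finsupp.finite_of_degree_le D).fintype

/-- The monomial function `y ↦ ∏ y_i ^ m_i`. -/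
def monoFun {d D : ℕ} (m : Expo d D) (y : Fin d → ℝ) : ℝ := ∏ i, y i ^ m.1 i

theorem eval_mem_span_monoFun {d D : ℕ} {q : MvPolynomial (Fin d) ℂ} (hq : q.totalDegree ≤ D) :
    (fun y : Fin d → ℝ => MvPolynomial.eval (fun i => (y i : ℂ)) q) ∈
      Submodule.span ℂ (Set.range fun (j : Expo d D) y => (monoFun j y : ℂ)) := by
  have h : (fun y : Fin d → ℝ => MvPolynomial.eval (fun i => (y i : ℂ)) q) =
      ∑ m ∈ q.support, q.coeff m • fun y : Fin d → ℝ => ∏ i, (y i : ℂ) ^ m i := by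
    funext y
    simp [MvPolynomial.eval_eq']
  rw [h]
  refine Submodule.sum_mem _ fun m hm => Submodule.smul_mem _ _ (Submodule.subset_span ?_)
  refine ⟨⟨m, (MvPolynomial.le_totalDegree hm).trans hq⟩, ?_⟩
  funext y
  simp [monoFun]

/-- A monomial of degree `|m| ≤ L` pulls back to `(1 + |y|²)^(L - |m|)` times `|m|` factors of
degree at most two, so the total degree is at most `2L`. -/
theorem stereoSpan_monoFun (d L : ℕ) : StereoSpan d L (monoFun (d := d) (D := 2 * L)) := by
  intro b f hf
  obtain ⟨p, hp, rfl⟩ := exists_mvPolynomial_of_mem_PiSpace hf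
  simp only [restrictSph_stereo b hp]
  let S : MvPolynomial (Fin d) ℂ := ∑ i, MvPolynomial.X i ^ 2
  let T : Fin (d + 1) → MvPolynomial (Fin d) ℂ := fun k => MvPolynomial.C (((b 0) k : ℝ) : ℂ) *
    (1 - S) + ∑ i : Fin d, MvPolynomial.C ((2 * (b i.succ) k : ℝ) : ℂ) * MvPolynomial.X i
  have hS : S.totalDegree ≤ 2 :=
    MvPolynomial.totalDegree_finsetSum_le fun i _ => by
      simp [MvPolynomial.totalDegree_X_pow]
  have hS1 : (1 + S).totalDegree ≤ 2 := (MvPolynomial.totalDegree_add _ _).trans (by simp [hS])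
  have hT : ∀ k, (T k).totalDegree ≤ 2 := by
    intro k
    refine (MvPolynomial.totalDegree_add _ _).trans (max_le ?_ ?_)
    · refine (MvPolynomial.totalDegree_mul _ _).trans ?_
      rw [MvPolynomial.totalDegree_C, zero_add]
      exact (MvPolynomial.totalDegree_sub _ _).trans (by simp [hS])
    · refine MvPolynomial.totalDegree_finsetSum_le fun i _ => ?_
      refine (MvPolynomial.totalDegree_mul _ _).trans ?_
      rw [MvPolynomial.totalDegree_C, MvPolynomial.totalDegree_X]
      norm_num
  have heS : ∀ y : Fin d → ℝ, MvPolynomial.eval (fun i => (y i : ℂ)) S = (sqLen y : ℂ) := by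
    intro y
    simp [S, sqLen]
  have heT : ∀ (y : Fin d → ℝ) k,
      MvPolynomial.eval (fun i => (y i : ℂ)) (T k) = (stereoCoord b k y : ℂ) := by
    intro y k
    simp only [T, map_add, map_sub, map_mul, map_sum, map_one, MvPolynomial.eval_C,
      MvPolynomial.eval_X, heS, stereoCoord, Fin.sum_univ_succ, stereoNum, Fin.cons_zero,
      Fin.cons_succ]
    push_cast
    congr 1
    · ring
    · exact Finset.sum_congr rfl fun i _ => by ring
  let q : MvPolynomial (Fin d) ℂ := ∑ m ∈ p.support, MvPolynomial.C (p.coeff m) *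
    ((1 + S) ^ (L - m.degree) * ∏ k, T k ^ m k)
  have hq : q.totalDegree ≤ 2 * L := by
    refine MvPolynomial.totalDegree_finsetSum_le fun m hm => ?_
    have hdeg : m.degree ≤ L := (MvPolynomial.le_totalDegree hm).trans hp
    have h1 : ((1 + S) ^ (L - m.degree)).totalDegree ≤ (L - m.degree) * 2 :=
      (MvPolynomial.totalDegree_pow _ _).trans (Nat.mul_le_mul_left _ hS1)
    have h2 : (∏ k, T k ^ m k).totalDegree ≤ m.degree * 2 := by
      refine (MvPolynomial.totalDegree_finsetProd _ _).trans ?_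
      rw [Finsupp.degree_eq_sum, Finset.sum_mul]
      exact Finset.sum_le_sum fun k _ => (MvPolynomial.totalDegree_pow _ _).trans
        (Nat.mul_le_mul_left _ (hT k))
    refine (MvPolynomial.totalDegree_mul _ _).trans ?_
    rw [MvPolynomial.totalDegree_C]
    have h3 := MvPolynomial.totalDegree_mul ((1 + S) ^ (L - m.degree)) (∏ k, T k ^ m k)
    omega
  convert eval_mem_span_monoFun hq using 1
  funext y
  simp only [q, map_sum, map_mul, map_pow, map_prod, map_add, map_one, MvPolynomial.eval_C, heS,
    heT]
  push_cast
  rfl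

theorem monoFun_smul {d D : ℕ} (m : Expo d D) (s : ℝ) (y : Fin d → ℝ) :
    monoFun m (s • y) = s ^ m.1.degree * monoFun m y := by
  simp [monoFun, mul_pow, Finset.prod_mul_distrib, Finset.prod_pow_eq_pow_sum,
    Finsupp.degree_eq_sum]

theorem abs_monoFun_le {d L : ℕ} (m : Expo d (2 * L)) (y : Fin d → ℝ) :
    |monoFun m y| ≤ (1 + sqLen y) ^ L := by
  have h1 : ∀ i, |y i| ≤ √(1 + sqLen y) := fun i =>
    Real.abs_le_sqrt (by linarith [sq_le_sqLen y i])
  have h2 : 1 ≤ √(1 + sqLen y) := Real.one_le_sqrt.mpr (by linarith [sqLen_nonneg y])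
  rw [monoFun, Finset.abs_prod]
  calc ∏ i, |y i ^ m.1 i| ≤ ∏ i, √(1 + sqLen y) ^ m.1 i := by
        refine Finset.prod_le_prod (fun _ _ => abs_nonneg _) fun i _ => ?_
        rw [abs_pow]
        exact pow_le_pow_left₀ (abs_nonneg _) (h1 i) _
    _ = √(1 + sqLen y) ^ m.1.degree := by
        rw [Finset.prod_pow_eq_pow_sum, Finsupp.degree_eq_sum]
    _ ≤ √(1 + sqLen y) ^ (2 * L) := pow_le_pow_right₀ h2 m.2
    _ = (1 + sqLen y) ^ L := by
        rw [pow_mul, Real.sq_sqrt (one_add_sqLen_pos y).le]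

/-! ### A unisolvent grid -/

/-- A grid of mesh `1 / ((D + 1) (d + 1))` in the unit ball of `ℝ^d`. -/
noncomputable def gridPoint (d D : ℕ) (k : Fin d → Fin (D + 1)) : Fin d → ℝ := fun i =>
  (k i : ℝ) / ((D + 1) * (d + 1))

theorem gridPoint_injective (d D : ℕ) : Function.Injective (gridPoint d D) := by
  intro k l h
  funext i
  have h1 := congrFun h i
  simp only [gridPoint] at h1
  rw [div_left_inj' (by positivity)] at h1
  exact Fin.ext (by exact_mod_cast h1)

theorem sqLen_gridPoint_lt (d D : ℕ) (k : Fin d → Fin (D + 1)) : sqLen (gridPoint d D k) < 1 := by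
  have h1 : ∀ i, gridPoint d D k i ^ 2 ≤ (1 / (d + 1 : ℝ)) ^ 2 := by
    intro i
    have h2 : (k i : ℝ) ≤ D + 1 := by exact_mod_cast (k i).2.le
    refine pow_le_pow_left₀ (by unfold gridPoint; positivity) ?_ 2
    rw [gridPoint, div_le_div_iff₀ (by positivity) (by positivity)]
    nlinarith [(by positivity : (0 : ℝ) < d + 1)]
  refine (Finset.sum_le_sum fun i _ => h1 i).trans_lt ?_
  rw [Finset.sum_const, Finset.card_univ, Fintype.card_fin, nsmul_eq_mul, div_pow, one_pow,
    mul_one_div, div_lt_one (by positivity)]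
  nlinarith [(by positivity : (0 : ℝ) ≤ d)]

/-- A polynomial of degree at most `D` in each variable that vanishes on a product of sets of `D +
1` nodes is zero. -/
theorem eq_zero_of_forall_gridPoint {d D : ℕ} (c : Expo d D → ℂ)
    (h : ∀ k, ∑ m, c m * (monoFun m (gridPoint d D k) : ℂ) = 0) : c = 0 := by
  classical
  let P : MvPolynomial (Fin d) ℂ := ∑ m : Expo d D, MvPolynomial.monomial m.1 (c m)
  let g : Fin (D + 1) → ℂ := fun k => (((k : ℝ) / ((D + 1) * (d + 1)) : ℝ) : ℂ)
  have hg : Function.Injective g := by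
    intro k l hkl
    have h1 := Complex.ofReal_injective hkl
    rw [div_left_inj' (by positivity)] at h1
    exact Fin.ext (by exact_mod_cast h1)
  have hdeg : P.totalDegree ≤ D :=
    MvPolynomial.totalDegree_finsetSum_le fun m _ =>
      (MvPolynomial.totalDegree_monomial_le _ _).trans m.2
  have hP : P = 0 := by
    refine MvPolynomial.eq_zero_of_eval_zero_at_prod_finset P
      (fun _ => Finset.univ.image g) (fun i => ?_) fun x hx => ?_
    · rw [Finset.card_image_of_injective _ hg, Finset.card_univ, Fintype.card_fin]
      exact Nat.lt_succ_of_le ((MvPolynomial.degreeOf_le_totalDegree _ _).trans hdeg)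
    · simp only [Finset.mem_image, Finset.mem_univ, true_and] at hx
      choose k hk using hx
      rw [← h k]
      simp only [P, map_sum]
      refine Finset.sum_congr rfl fun m _ => ?_
      rw [MvPolynomial.eval_monomial, Finsupp.prod_fintype _ _ (fun _ => pow_zero _)]
      congr 1
      rw [monoFun, Complex.ofReal_prod]
      refine Finset.prod_congr rfl fun i _ => ?_
      rw [← hk i, Complex.ofReal_pow]
      rfl
  funext m
  have h1 := congrArg (MvPolynomial.coeff m.1) hP
  simp only [P, MvPolynomial.coeff_sum, MvPolynomial.coeff_monomial, MvPolynomial.coeff_zero] at h1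
  rw [Finset.sum_eq_single m] at h1
  · simpa using h1
  · intro m' _ hne
    rw [if_neg fun he => hne (Subtype.ext he)]
  · simp

/-! ### The chart in degree one on `𝕊²` -/

/-- The functions `1`, `|y|²`, `y_0`, `y_1`. -/
def affFun : Option (Option (Fin 2)) → (Fin 2 → ℝ) → ℝ
  | none, _ => 1
  | some none, y => sqLen y
  | some (some i), y => y i

/-- The degrees of homogeneity of `affFun`. -/
def affDeg : Option (Option (Fin 2)) → ℕ
  | none => 0
  | some none => 2
  | some (some _) => 1

/-- Constants become multiples of `1 + |y|²`, and each ambient coordinate a combination of `1 -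
|y|²`, `y_0` and `y_1`. -/
theorem stereoSpan_affFun : StereoSpan 2 1 affFun := by
  intro b f hf
  obtain ⟨p, hp, rfl⟩ := exists_mvPolynomial_of_mem_PiSpace hf
  simp only [restrictSph_stereo b hp]
  set V := Submodule.span ℂ (Set.range fun j y => (affFun j y : ℂ))
  have hj : ∀ j, (fun y => (affFun j y : ℂ)) ∈ V := fun j => Submodule.subset_span ⟨j, rfl⟩
  have hsum : (fun y : Fin 2 → ℝ => ∑ m ∈ p.support, p.coeff m *
      (((1 + sqLen y) ^ (1 - m.degree) : ℝ) * ∏ k, (stereoCoord b k y : ℂ) ^ m k)) =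
      ∑ m ∈ p.support, p.coeff m • fun y : Fin 2 → ℝ =>
        (((1 + sqLen y) ^ (1 - m.degree) : ℝ) * ∏ k, (stereoCoord b k y : ℂ) ^ m k) := by
    funext y
    simp
  rw [hsum]
  refine Submodule.sum_mem _ fun m hm => Submodule.smul_mem _ _ ?_
  have hdeg : m.degree ≤ 1 := (MvPolynomial.le_totalDegree hm).trans hp
  rcases Nat.le_one_iff_eq_zero_or_eq_one.mp hdeg with h0 | h1
  · rw [Finsupp.degree_eq_zero_iff] at h0
    subst h0
    convert V.add_mem (hj none) (hj (some none)) using 1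
    funext y
    simp [affFun]
  · obtain ⟨k, rfl⟩ : m ∈ Set.range fun k => Finsupp.single k 1 := by
      rw [Finsupp.range_single_one]
      exact h1
    have hk : (fun y => (stereoCoord b k y : ℂ)) ∈ V := by
      convert V.add_mem (V.smul_mem (((b 0) k : ℝ) : ℂ) (V.sub_mem (hj none) (hj (some none))))
        (V.add_mem (V.smul_mem (((2 * (b 1) k : ℝ)) : ℂ) (hj (some (some 0))))
          (V.smul_mem (((2 * (b 2) k : ℝ)) : ℂ) (hj (some (some 1))))) using 1
      funext y
      simp [stereoCoord, affFun, Fin.sum_univ_succ, stereoNum]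
      ring
    convert hk using 1
    funext y
    rw [h1, Finset.prod_eq_single k]
    · simp
    · intro l _ hl
      simp [Finsupp.single_eq_of_ne hl]
    · simp

/-! ### Sampling inequalities on caps -/

/-- For some mesh ratio and all small radii, sampling on well-distributed finite subsets of caps of
radius `r` controls the sup norm on `Π_L` with constant `M (r/2)^(4L)`. -/
def SamplingBound (d L : ℕ) (M : ℝ) : Prop :=
  ∃ c₀ r₀ : ℝ, 0 < c₀ ∧ 0 < r₀ ∧ ∀ f ∈ PiSpace d L, ∀ (ξ : Sph d) (r : ℝ), 0 < r → r < r₀ →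
    ∀ Z : Finset (Sph d), (Z : Set (Sph d)) ⊆ cap ξ r →
      meshNorm (cap ξ r) Z ≤ ENNReal.ofReal (c₀ * r) →
      ∀ x, M * (r / 2) ^ (2 * (2 * L)) * ‖f x‖ ^ 2 ≤ ∑ ζ ∈ Z, ‖f ζ‖ ^ 2

/-- The family `φ` and the nodes `p` stay abstract: the general case takes all monomials on a grid,
while degree one on `𝕊²` takes `affFun` on five points to get an explicit `M`. -/
theorem samplingBound_of_stereoSpan {d L : ℕ} (hd : 1 ≤ d) {n I : Type*} [Fintype n] [Fintype I]
    (φ : n → (Fin d → ℝ) → ℝ) (k : n → ℕ) (hφc : ∀ j, Continuous (φ j))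
    (hk : ∀ j, k j ≤ 2 * L) (hφ : ∀ j (s : ℝ) y, φ j (s • y) = s ^ k j * φ j y)
    (hφb : ∀ j y, |φ j y| ≤ (1 + sqLen y) ^ L) (hspan : StereoSpan d L φ)
    (p : I → Fin d → ℝ) (hp : Function.Injective p) (hp1 : ∀ i, sqLen (p i) < 1)
    (M : ℝ) (hM0 : 0 < M)
    (hM : ∀ c : n → ℂ, c ≠ 0 → M * (∑ j, (0 : ℝ) ^ (2 * L - k j) * ‖c j‖) ^ 2 <
      ∑ i, ‖∑ j, c j * (φ j (p i) : ℂ)‖ ^ 2) :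
    SamplingBound d L M := by
  classical
  obtain ⟨δ, hδ, hcore⟩ := exists_scaled_lower_bound (L := L) φ k hφc hk hφ p hp M hM
  -- The mesh puts `ζ_i` within `δr/8` of its target, the chart at most doubles this, and division
  -- by `s = r/2` leaves less than `δ/2`. The bound `r < 1` keeps the cap in the hemisphere around
  -- `ξ`.
  refine ⟨δ / 16, min 1 δ, by positivity, by positivity, ?_⟩
  intro f hf ξ r hr hr0 Z hZ hmesh x
  have hr1 : r < 1 := hr0.trans_le (min_le_left _ _)
  have hrδ : r < δ := hr0.trans_le (min_le_right _ _)
  obtain ⟨b, hb⟩ := exists_orthonormalBasis_zero_eq ξ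
  obtain ⟨c, hc⟩ := (Submodule.mem_span_range_iff_exists_fun ℂ).mp (hspan b f hf)
  have hfc : ∀ y, f (stereo b y) = (((1 + sqLen y) ^ L)⁻¹ : ℝ) • ∑ j, c j * (φ j y : ℂ) := by
    intro y
    have h1 := congrFun hc y
    simp only [Finset.sum_apply, Pi.smul_apply, smul_eq_mul] at h1
    have h2 : (((1 + sqLen y) ^ L : ℝ) : ℂ) ≠ 0 := by
      exact_mod_cast (pow_pos (one_add_sqLen_pos y) L).ne'
    rw [h1, Complex.real_smul, Complex.ofReal_inv, inv_mul_cancel_left₀ h2]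
  have hsup : ‖f x‖ ≤ ∑ j, ‖c j‖ := by
    refine forall_norm_le_of_stereo hd b (continuous_of_mem_PiSpace hf) (fun y => ?_) x
    have hpos : 0 < (1 + sqLen y) ^ L := pow_pos (one_add_sqLen_pos y) L
    rw [hfc, norm_smul, norm_inv, Real.norm_of_nonneg hpos.le, inv_mul_le_iff₀ hpos,
      Finset.mul_sum]
    refine (norm_sum_le _ _).trans (Finset.sum_le_sum fun j _ => ?_)
    rw [norm_mul, Complex.norm_real, Real.norm_eq_abs, mul_comm]
    exact mul_le_mul_of_nonneg_right (hφb j y) (norm_nonneg _)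
  set s := r / 2 with hs
  have hs0 : 0 < s := by positivity
  have hlen : ∀ i, sqLen (s • p i) < s ^ 2 := fun i => by
    rw [sqLen_smul]
    exact mul_lt_of_lt_one_right (by positivity) (hp1 i)
  have hex : ∀ i, ∃ ζ ∈ Z, sdist (stereo b (s • p i)) ζ < δ / 8 * r := fun i =>
    exists_sdist_lt_of_meshNorm_le hmesh (by positivity) (by nlinarith [mul_pos hδ hr])
      (stereo_mem_cap b hb hr _ (hlen i))
  choose ζ hζZ hζd using hex
  have hin : ∀ i, 0 ≤ inner ℝ (b 0) (ζ i : EuclideanSpace ℝ (Fin (d + 1))) := fun i => by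
    rw [hb]
    exact inner_nonneg_of_mem_cap hr1.le (hZ (hζZ i))
  have hst : ∀ i, stereo b (s • s⁻¹ • stereoInv b (ζ i)) = ζ i := fun i => by
    rw [smul_inv_smul₀ hs0.ne']
    exact stereo_stereoInv b _ (by linarith [hin i])
  obtain ⟨hinj, hbound⟩ := hcore s hs0 (by linarith) (fun i => s⁻¹ • stereoInv b (ζ i)) (by
    intro i
    rw [dist_pi_lt_iff hδ]
    intro l
    have h1 := abs_stereoInv_sub_le b (s • p i) ((hlen i).le.trans (by nlinarith)) (ζ i) (hin i) l
    have h2 : |s⁻¹ * stereoInv b (ζ i) l - p i l| = s⁻¹ * |stereoInv b (ζ i) l - (s • p i) l| := by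
      rw [← abs_of_pos (inv_pos.mpr hs0), ← abs_mul, abs_of_pos (inv_pos.mpr hs0), mul_sub,
        Pi.smul_apply, smul_eq_mul, inv_mul_cancel_left₀ hs0.ne']
    rw [Real.dist_eq, Pi.smul_apply, smul_eq_mul, h2, inv_mul_lt_iff₀ hs0]
    have h3 := hζd i
    rw [hs]
    nlinarith)
  -- Distinct nodes must select distinct points of `Z`, or a value would be counted twice.
  have hζinj : Function.Injective ζ := fun i j hij => hinj (by simp only [hij])
  calc M * s ^ (2 * (2 * L)) * ‖f x‖ ^ 2
      ≤ M * s ^ (2 * (2 * L)) * (∑ j, ‖c j‖) ^ 2 :=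
        mul_le_mul_of_nonneg_left (pow_le_pow_left₀ (norm_nonneg _) hsup 2) (by positivity)
    _ ≤ ∑ i, ‖f (ζ i)‖ ^ 2 := by
        refine (hbound c).trans_eq (Finset.sum_congr rfl fun i _ => ?_)
        rw [← hfc, hst]
    _ = ∑ x ∈ Finset.univ.image ζ, ‖f x‖ ^ 2 := by
        rw [Finset.sum_image fun i _ j _ h => hζinj h]
    _ ≤ ∑ x ∈ Z, ‖f x‖ ^ 2 := by
        refine Finset.sum_le_sum_of_subset_of_nonneg (fun x hx => ?_) fun _ _ _ => sq_nonneg _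
        obtain ⟨i, -, rfl⟩ := Finset.mem_image.mp hx
        exact hζZ i

theorem exists_samplingBound {d : ℕ} (hd : 1 ≤ d) (L : ℕ) :
    ∃ M : ℝ, 0 < M ∧ SamplingBound d L M := by
  obtain ⟨M, hM, hlt⟩ := exists_pos_mul_sq_lt
    (fun (k : Fin d → Fin (2 * L + 1)) (m : Expo d (2 * L)) => monoFun m (gridPoint d (2 * L) k))
    (fun m => (0 : ℝ) ^ (2 * L - m.1.degree)) eq_zero_of_forall_gridPoint
  exact ⟨M, hM, samplingBound_of_stereoSpan hd monoFun (fun m => m.1.degree)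
    (fun m => by unfold monoFun; fun_prop) (fun m => m.2) monoFun_smul abs_monoFun_le
    (stereoSpan_monoFun d L) _ (gridPoint_injective d (2 * L)) (sqLen_gridPoint_lt d (2 * L))
    M hM hlt⟩

/-- The points `0, ±9/10 e_0, ±9/10 e_1` of the plane. -/
noncomputable def crossPoint : Option (Fin 2 × Bool) → Fin 2 → ℝ
  | none => 0
  | some (i, true) => Pi.single i (9 / 10)
  | some (i, false) => Pi.single i (-9 / 10)

/-- Only the coefficient `D` of `|y|²` has top degree. With `u = (81/100) D`, the sum contains `|A|²
+ 4 |A + u|² ≥ (4/5) |u|²`, and `(4/5) (81/100)² > 1/4`. The radius `9/10` keeps the nodes in the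
open unit ball. -/
theorem sum_norm_crossPoint (c : Option (Option (Fin 2)) → ℂ) (hc : c ≠ 0) :
    1 / 4 * (∑ j, (0 : ℝ) ^ (2 * 1 - affDeg j) * ‖c j‖) ^ 2 <
      ∑ i, ‖∑ j, c j * (affFun j (crossPoint i) : ℂ)‖ ^ 2 := by
  set A := c none with hA
  set D := c (some none) with hD
  set B := c (some (some 0)) with hB
  set E := c (some (some 1)) with hE
  have hne : A ≠ 0 ∨ D ≠ 0 ∨ B ≠ 0 ∨ E ≠ 0 := by
    by_contra! h
    refine hc (funext fun j => ?_)
    match j with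
    | none => exact h.1
    | some none => exact h.2.1
    | some (some 0) => exact h.2.2.1
    | some (some 1) => exact h.2.2.2
  have hpos : 0 < ‖A‖ ^ 2 + ‖D‖ ^ 2 + ‖B‖ ^ 2 + ‖E‖ ^ 2 := by
    rcases hne with h | h | h | h <;> have := norm_pos_iff.mpr h <;> positivity
  simp only [Fintype.sum_option, Fintype.sum_prod_type, Fin.sum_univ_two, Fintype.sum_bool,
    affFun, affDeg, crossPoint, sqLen, Pi.zero_apply, Pi.single_eq_same, ← hA, ← hD, ← hB, ← hE,
    Pi.single_eq_of_ne (show (1 : Fin 2) ≠ 0 by decide),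
    Pi.single_eq_of_ne (show (0 : Fin 2) ≠ 1 by decide)]
  simp only [Complex.sq_norm, Complex.normSq_apply] at hpos ⊢
  norm_num [Complex.normSq_apply]
  rw [Complex.sq_norm, Complex.normSq_apply]
  -- The hints complete the square in `A`, for real and imaginary parts.
  nlinarith [sq_nonneg (5 * A.re + 4 * (81 / 100) * D.re),
    sq_nonneg (5 * A.im + 4 * (81 / 100) * D.im)]

theorem crossPoint_injective : Function.Injective crossPoint := by
  intro i j h
  have h0 := congrFun h 0
  have h1 := congrFun h 1
  rcases i with _ | ⟨i, _ | _⟩ <;> rcases j with _ | ⟨j, _ | _⟩ <;> (try fin_cases i) <;>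
    (try fin_cases j) <;> simp [crossPoint] at h0 h1 ⊢ <;> (try norm_num at h0) <;>
    (try norm_num at h1)

theorem samplingBound_two_one : SamplingBound 2 1 (1 / 4) := by
  refine samplingBound_of_stereoSpan (by norm_num) affFun affDeg ?_ ?_ ?_ ?_ stereoSpan_affFun
    crossPoint crossPoint_injective ?_ _ (by norm_num) sum_norm_crossPoint
  · rintro (_ | _ | i) <;> unfold affFun <;> fun_prop
  · rintro (_ | _ | i) <;> simp [affDeg]
  · rintro (_ | _ | i) s y <;> simp [affDeg, affFun, sqLen_smul]
  · rintro (_ | _ | i) y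
    · simp [affFun, sqLen_nonneg]
    · simp [affFun, abs_of_nonneg, sqLen_nonneg]
    · simp only [affFun, pow_one]
      nlinarith [sq_le_sqLen y i, sq_abs (y i), sq_nonneg (|y i| - 1), abs_nonneg (y i)]
  · rintro (_ | ⟨i, _ | _⟩) <;> simp only [crossPoint, sqLen, Fin.sum_univ_two] <;>
      (try fin_cases i) <;> simp <;> norm_num

/-! ### From sampling to the Gram matrix -/

/-- By Cauchy–Schwarz the hypothesis gives `κ ‖v‖ ≤ ‖A v‖`, which is injectivity and, at `v = A⁻¹
w`, the norm bound. -/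
theorem isUnit_and_norm_inv_le {J : Type*} [Fintype J] [DecidableEq J] (A : Matrix J J ℂ) {κ : ℝ}
    (hκ : 0 < κ)
    (h : ∀ v : J → ℂ, κ * ∑ j, ‖v j‖ ^ 2 ≤ ‖star v ⬝ᵥ A.mulVec v‖) :
    IsUnit A ∧ ‖A⁻¹‖ ≤ κ⁻¹ := by
  have hlow : ∀ v : J → ℂ, κ * ‖WithLp.toLp 2 v‖ ≤ ‖WithLp.toLp 2 (A.mulVec v)‖ := by
    intro v
    have h1 := h v
    have h2 : star v ⬝ᵥ A.mulVec v =
        inner ℂ (WithLp.toLp 2 v) (WithLp.toLp 2 (A.mulVec v)) := by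
      rw [EuclideanSpace.inner_toLp_toLp, dotProduct_comm]
    rw [h2, ← EuclideanSpace.norm_sq_eq (WithLp.toLp 2 v)] at h1
    have h3 := h1.trans (norm_inner_le_norm _ _)
    rcases (norm_nonneg (WithLp.toLp 2 v)).eq_or_lt with h0 | h0
    · rw [← h0, mul_zero]
      exact norm_nonneg _
    · refine le_of_mul_le_mul_left ?_ h0
      linarith
  have hu : IsUnit A := by
    rw [← Matrix.mulVec_injective_iff_isUnit]
    intro v w hvw
    have h1 := hlow (v - w)
    rw [Matrix.mulVec_sub, sub_eq_zero.mpr hvw, WithLp.toLp_zero, norm_zero] at h1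
    have h2 : ‖WithLp.toLp 2 (v - w)‖ = 0 :=
      le_antisymm (nonpos_of_mul_nonpos_right h1 hκ) (norm_nonneg _)
    rw [norm_eq_zero, WithLp.toLp_eq_zero] at h2
    exact sub_eq_zero.mp h2
  refine ⟨hu, ?_⟩
  rw [← Matrix.l2_opNorm_toEuclideanCLM]
  refine ContinuousLinearMap.opNorm_le_bound _ (inv_nonneg.mpr hκ.le) fun w => ?_
  have h1 := hlow (A⁻¹.mulVec w.ofLp)
  rw [Matrix.mulVec_mulVec, Matrix.mul_nonsing_inv _ ((Matrix.isUnit_iff_isUnit_det A).mp hu),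
    Matrix.one_mulVec] at h1
  rw [le_inv_mul_iff₀ hκ]
  exact h1

theorem star_dotProduct_gram_mulVec {d : ℕ} {J : Type} [Fintype J] (Y : J → Sph d → ℂ)
    (Z : Finset (Sph d)) (v : J → ℂ) :
    star v ⬝ᵥ (gram Y Z).mulVec v =
      ((∑ ζ ∈ Z, ‖∑ j, (starRingEnd ℂ) (v j) * Y j ζ‖ ^ 2 : ℝ) : ℂ) := by
  simp only [dotProduct, Matrix.mulVec, gram, Matrix.of_apply, Pi.star_apply, Finset.sum_mul,
    Finset.mul_sum]
  push_cast
  simp_rw [← Complex.mul_conj', map_sum, Finset.sum_mul_sum, map_mul, Complex.conj_conj]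
  rw [Finset.sum_comm' (t' := Finset.univ) (s' := fun _ => Finset.univ) (by simp)]
  rw [Finset.sum_comm]
  simp_rw [Finset.sum_comm (s := Z)]
  refine Finset.sum_congr rfl fun j _ => Finset.sum_congr rfl fun k _ =>
    Finset.sum_congr rfl fun ζ _ => ?_
  change (starRingEnd ℂ) _ * _ = _
  ring

instance isFiniteMeasure_surf (d : ℕ) : MeasureTheory.IsFiniteMeasure (surf d) := by
  unfold surf
  infer_instance

theorem integral_norm_sq_eq {d L : ℕ} {J : Type} [Fintype J] [DecidableEq J] {Y : J → Sph d → ℂ}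
    (hY : IsONBasis L Y) (v : J → ℂ) :
    ∫ x, ‖∑ j, (starRingEnd ℂ) (v j) * Y j x‖ ^ 2 ∂(surf d) = ∑ j, ‖v j‖ ^ 2 := by
  have hmem : ∀ j, Y j ∈ PiSpace d L := fun j => hY.span_eq ▸ Submodule.subset_span ⟨j, rfl⟩
  have hcont : ∀ j, Continuous (Y j) := fun j => continuous_of_mem_PiSpace (hmem j)
  have hint : ∀ g : Sph d → ℂ, Continuous g → MeasureTheory.Integrable g (surf d) := fun g hg =>
    hg.integrable_of_hasCompactSupport (HasCompactSupport.of_compactSpace g)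
  have h : ∫ x, ((‖∑ j, (starRingEnd ℂ) (v j) * Y j x‖ ^ 2 : ℝ) : ℂ) ∂(surf d) =
      ((∑ j, ‖v j‖ ^ 2 : ℝ) : ℂ) := by
    have h1 : ∀ x, ((‖∑ j, (starRingEnd ℂ) (v j) * Y j x‖ ^ 2 : ℝ) : ℂ) =
        ∑ j, ∑ k, (starRingEnd ℂ) (v j) * v k * (Y j x * (starRingEnd ℂ) (Y k x)) := by
      intro x
      push_cast
      rw [← Complex.mul_conj', map_sum, Finset.sum_mul_sum]
      refine Finset.sum_congr rfl fun j _ => Finset.sum_congr rfl fun k _ => ?_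
      rw [map_mul, Complex.conj_conj]
      ring
    have hjk : ∀ j k, Continuous fun x =>
        (starRingEnd ℂ) (v j) * v k * (Y j x * (starRingEnd ℂ) (Y k x)) := fun j k =>
      continuous_const.mul ((hcont j).mul (Complex.continuous_conj.comp (hcont k)))
    simp_rw [h1]
    rw [MeasureTheory.integral_finsetSum _ fun j _ =>
      MeasureTheory.integrable_finsetSum _ fun k _ => hint _ (hjk j k)]
    push_cast
    refine Finset.sum_congr rfl fun j _ => ?_
    rw [MeasureTheory.integral_finsetSum _ fun k _ => hint _ (hjk j k)]
    simp_rw [MeasureTheory.integral_const_mul, hY.orthonormal]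
    simp [Complex.conj_mul']
  rw [integral_complex_ofReal] at h
  exact_mod_cast h

/-- For `f = ∑ conj(v_j) Y_j` the sum on the right is the quadratic form of the Gram matrix at `v`.
Integrating over `x` turns the left side into `a ‖v‖²` and multiplies the right side by the total
mass. -/
theorem isUnit_gram_and_norm_inv_le {d L : ℕ} {J : Type} [Fintype J] [DecidableEq J]
    {Y : J → Sph d → ℂ} (hY : IsONBasis L Y) (Z : Finset (Sph d)) {a : ℝ} (ha : 0 < a)
    (hμ : 0 < (surf d).real Set.univ)
    (h : ∀ f ∈ PiSpace d L, ∀ x, a * ‖f x‖ ^ 2 ≤ ∑ ζ ∈ Z, ‖f ζ‖ ^ 2) :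
    IsUnit (gram Y Z) ∧ ‖(gram Y Z)⁻¹‖ ≤ (surf d).real Set.univ / a := by
  have hmem : ∀ j, Y j ∈ PiSpace d L := fun j => hY.span_eq ▸ Submodule.subset_span ⟨j, rfl⟩
  rw [← inv_div]
  refine isUnit_and_norm_inv_le _ (by positivity) fun v => ?_
  rw [star_dotProduct_gram_mulVec, Complex.norm_real,
    Real.norm_of_nonneg (Finset.sum_nonneg fun _ _ => sq_nonneg _), div_mul_eq_mul_div,
    div_le_iff₀ hμ, ← integral_norm_sq_eq hY]
  set f : Sph d → ℂ := ∑ j, (starRingEnd ℂ) (v j) • Y j with hf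
  have hfmem : f ∈ PiSpace d L :=
    Submodule.sum_mem _ fun j _ => Submodule.smul_mem _ _ (hmem j)
  have hfx : ∀ x, ∑ j, (starRingEnd ℂ) (v j) * Y j x = f x := fun x => by simp [hf]
  simp_rw [hfx]
  have hc : Continuous fun x => a * ‖f x‖ ^ 2 :=
    continuous_const.mul ((continuous_of_mem_PiSpace hfmem).norm.pow 2)
  rw [← MeasureTheory.integral_const_mul]
  calc ∫ x, a * ‖f x‖ ^ 2 ∂(surf d) ≤ ∫ _, (∑ ζ ∈ Z, ‖f ζ‖ ^ 2) ∂(surf d) :=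
        MeasureTheory.integral_mono
          (hc.integrable_of_hasCompactSupport (HasCompactSupport.of_compactSpace _))
          (MeasureTheory.integrable_const _) fun x => h f hfmem x
    _ = _ := by rw [MeasureTheory.integral_const, smul_eq_mul, mul_comm]

/-! ### Total mass and conclusion -/

theorem surf_real_univ (d : ℕ) : (surf d).real Set.univ =
    (d + 1) * (MeasureTheory.volume (Metric.ball (0 : EuclideanSpace ℝ (Fin (d + 1))) 1)).toReal := by
  rw [MeasureTheory.measureReal_def, surf, MeasureTheory.Measure.toSphere_apply_univ,
    finrank_euclideanSpace_fin, ENNReal.toReal_mul, ENNReal.toReal_natCast]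
  push_cast
  rfl

theorem surf_real_univ_pos (d : ℕ) : 0 < (surf d).real Set.univ := by
  rw [surf_real_univ]
  exact mul_pos (by positivity) (ENNReal.toReal_pos
    (Metric.measure_ball_pos _ _ one_pos).ne' MeasureTheory.measure_ball_lt_top.ne)

theorem surf_two_real_univ : (surf 2).real Set.univ = 4 * Real.pi := by
  rw [surf_real_univ, EuclideanSpace.volume_ball_fin_three, ENNReal.toReal_mul,
    ENNReal.toReal_ofReal (by positivity)]
  norm_num
  ring

theorem lemma6p3 (d L : ℕ) (hd : 2 ≤ d) :
    ∃ (c₀ r₀ C C' : ℝ) (ι : ℕ), 0 < c₀ ∧ 0 < r₀ ∧ 0 < C ∧ L ≤ ι ∧ (L = 1 → d = 2 → ι = 2) ∧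
      ∀ (J : Type) [Fintype J] [DecidableEq J] (Y : J → SphereGram.Sph d → ℂ),
        SphereGram.IsONBasis L Y →
        ∀ (ξ : SphereGram.Sph d) (r : ℝ), 0 < r → r < r₀ →
        ∀ Z : Finset (SphereGram.Sph d), (Z : Set (SphereGram.Sph d)) ⊆ SphereGram.cap ξ r →
          SphereGram.meshNorm (SphereGram.cap ξ r) Z ≤ ENNReal.ofReal (c₀ * r) →
          IsUnit (SphereGram.gram Y Z) ∧
          ‖(SphereGram.gram Y Z)⁻¹‖ ≤ C / r ^ (2 * ι) ∧
          (L = 1 → d = 2 →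
            ‖(SphereGram.gram Y Z)⁻¹‖ ≤ 256 * Real.pi / r ^ 4 + C' / r ^ 2) := by
  have hμ := surf_real_univ_pos d
  obtain ⟨M, hM, hM4, c₀, r₀, hc₀, hr₀, hsamp⟩ :
      ∃ M : ℝ, 0 < M ∧ (L = 1 → d = 2 → M = 1 / 4) ∧ SamplingBound d L M := by
    by_cases h : L = 1 ∧ d = 2
    · obtain ⟨rfl, rfl⟩ := h
      exact ⟨1 / 4, by norm_num, fun _ _ => rfl, samplingBound_two_one⟩
    · obtain ⟨M, hM, hs⟩ := exists_samplingBound (by omega : 1 ≤ d) L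
      exact ⟨M, hM, fun h1 h2 => absurd ⟨h1, h2⟩ h, hs⟩
  -- Here `C` comes from `μ(𝕊^d) / (M (r/2)^(4L))`, and `C' = 0` suffices since `4π · 2⁴ / (1/4) =
  -- 256π`.
  refine ⟨c₀, r₀, (surf d).real Set.univ * 2 ^ (2 * (2 * L)) / M, 0, 2 * L, hc₀, hr₀,
    by positivity, by omega, by omega, ?_⟩
  intro J _ _ Y hY ξ r hr hrr₀ Z hZ hmesh
  obtain ⟨hu, hn⟩ := isUnit_gram_and_norm_inv_le hY Z
    (a := M * (r / 2) ^ (2 * (2 * L))) (by positivity) hμ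
    fun f hf x => hsamp f hf ξ r hr hrr₀ Z hZ hmesh x
  have heq : (surf d).real Set.univ / (M * (r / 2) ^ (2 * (2 * L))) =
      (surf d).real Set.univ * 2 ^ (2 * (2 * L)) / M / r ^ (2 * (2 * L)) := by
    rw [div_pow]
    field_simp
  rw [heq] at hn
  refine ⟨hu, hn, fun h1 h2 => hn.trans_eq ?_⟩
  rw [hM4 h1 h2]
  subst h1 h2
  rw [surf_two_real_univ]
  norm_num
  ring
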